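/- For a function $B\colon\mathbb{Z}^2\to\mathbb{R}$ (a magnetic field) let $\mathfrak{s}_{B,1},\mathfrak{s}_{B,2}$ be the magnetic translations on $\ell^2(\mathbb{Z}^2)$, $$(\mathfrak{s}_{B,j}\psi)(n)=e^{\mathrm{i}A_B(n,n-e_j)}\,\psi(n-e_j),\qquad j=1,2,$$ where $e_1=(1,0)$, $e_2=(0,1)$ and $A_B$ is the standard vector potential of $B$: $A_B(n,n-e_2)=0$, and $A_B(n,n-e_1)$ equals $\sum_{m=1}^{n_2}B(n_1,m)$ if $n_2>0$, equals $0$ if $n_2=0$, and equals $-\sum_{m=0}^{|n_2|-1}B(n_1,-m)$ if $n_2<0$. Let $\mathfrak{A}_B=C^*(\mathfrak{s}_{B,1},\mathfrak{s}_{B,2})\subset\mathcal{B}(\ell^2(\mathbb{Z}^2))$ be the (unital) $C^*$-algebra generated by them. An evaluation homomorphism $\mathfrak{A}_{B}\to\mathfrak{A}_{B'}$ is a surjective unital $*$-homomorphism that maps $\mathfrak{s}_{B,j}$ to $\mathfrak{s}_{B',j}$ for $j=1,2$. Let $b_\llcorner,b_\ast\in\mathbb{R}$ with $b_\llcorner-b_\ast\notin2\pi\mathbb{Z}$.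 Let $B$ be the quarter-plane field, $B(n)=b_\ast$ if $n_1\le0$ or $n_2\le0$ and $B(n)=b_\llcorner$ otherwise; let $B_{\mathtt{R}}(n)=b_\ast$ if $n_2\le0$ and $B_{\mathtt{R}}(n)=b_\llcorner$ otherwise; let $B_{\mathtt{U}}(n)=b_\ast$ if $n_1\le0$ and $B_{\mathtt{U}}(n)=b_\llcorner$ otherwise. Write $\mathfrak{A}=\mathfrak{A}_B$, $\mathfrak{A}_{\mathtt{R}}=\mathfrak{A}_{B_{\mathtt{R}}}$, $\mathfrak{A}_{\mathtt{U}}=\mathfrak{A}_{B_{\mathtt{U}}}$. Then there are unique evaluation homomorphisms $\mathrm{ev}_{\mathtt{R}}\colon\mathfrak{A}\to\mathfrak{A}_{\mathtt{R}}$ and $\mathrm{ev}_{\mathtt{U}}\colon\mathfrak{A}\to\mathfrak{A}_{\mathtt{U}}$, and an element $\mathfrak{t}\in\mathfrak{A}$ is a Fredholm operator on $\ell^2(\mathbb{Z}^2)$ if and only if $\mathrm{ev}_{\mathtt{R}}(\mathfrak{t})$ and $\mathrm{ev}_{\mathtt{U}}(\mathfrak{t})$ are invertible in $\mathfrak{A}_{\mathtt{R}}$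 and $\mathfrak{A}_{\mathtt{U}}$, respectively. -/

import Mathlib

noncomputable section

/-- The Hilbert space `ℓ²(ℤ²)`. -/
abbrev LatticeSpace : Type := lp (fun _ : ℤ × ℤ => ℂ) 2

/-- The canonical basis `e₁ = (1,0)`, `e₂ = (0,1)` of `ℤ²`, indexed by `0` and `1`. -/
def latticeBasis (j : Fin 2) : ℤ × ℤ := if j = 0 then (1, 0) else (0, 1)

/-- The weighted translation `(S ψ)(n) = exp(i θ(n)) ψ(n - e)` on `ℓ²(ℤ²)`, which is an isometry. -/
def weightedTranslationIsometry (θ : ℤ × ℤ → ℝ) (e : ℤ × ℤ) :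
    LatticeSpace →ₗᵢ[ℂ] LatticeSpace where
  toFun ψ := ⟨fun n => Complex.exp (Complex.I * (θ n : ℂ)) * ψ (n - e), by
    apply memℓp_gen
    have h : Summable fun n => ‖ψ n‖ ^ (2 : ENNReal).toReal :=
      (lp.memℓp ψ).summable (by norm_num)
    have h' := (Equiv.subRight e).summable_iff.mpr h
    refine h'.congr fun n => ?_
    simp [mul_comm Complex.I, Complex.norm_exp_ofReal_mul_I]⟩
  map_add' ψ φ := by
    ext n
    exact mul_add _ _ _
  map_smul' c ψ := by
    ext n
    exact mul_left_comm _ _ _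
  norm_map' ψ := by
    rw [lp.norm_eq_tsum_rpow (by norm_num), lp.norm_eq_tsum_rpow (by norm_num)]
    congr 1
    rw [← (Equiv.subRight e).tsum_eq (fun n => ‖ψ n‖ ^ (2 : ENNReal).toReal)]
    refine tsum_congr fun n => ?_
    simp [mul_comm Complex.I, Complex.norm_exp_ofReal_mul_I]

/-- The value `A_B(n, n - e_j)` of the standard vector potential of a magnetic field `B` on `ℤ²`:
it vanishes for `j = 2`, and for `j = 1` it is `∑_{m=1}^{n₂} B(n₁,m)` if `n₂ > 0`,
`-∑_{m=0}^{|n₂|-1} B(n₁,-m)` if `n₂ < 0`, and `0` if `n₂ = 0`. -/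
def vectorPotential (B : ℤ × ℤ → ℝ) (j : Fin 2) (n : ℤ × ℤ) : ℝ :=
  if j = 0 then
    (if 0 < n.2 then ∑ m ∈ Finset.Icc 1 n.2, B (n.1, m) else 0)
      - (if n.2 < 0 then ∑ m ∈ Finset.Icc 0 (|n.2| - 1), B (n.1, -m) else 0)
  else 0

/-- The magnetic translation `(s_j ψ)(n) = exp(i A_B(n, n - e_j)) ψ(n - e_j)`. -/
def magneticTranslation (B : ℤ × ℤ → ℝ) (j : Fin 2) : LatticeSpace →L[ℂ] LatticeSpace :=
  (weightedTranslationIsometry (vectorPotential B j) (latticeBasis j)).toContinuousLinearMap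

theorem magneticTranslation_apply (B : ℤ × ℤ → ℝ) (j : Fin 2) (ψ : LatticeSpace) (n : ℤ × ℤ) :
    magneticTranslation B j ψ n =
      Complex.exp (Complex.I * (vectorPotential B j n : ℂ)) * ψ (n - latticeBasis j) :=
  rfl

/-- The magnetic algebra `C*(s₁, s₂)` of the field `B`: the norm closure, in the bounded operators
on `ℓ²(ℤ²)`, of the unital `*`-algebra generated by the magnetic translations. -/
def magneticAlgebra (B : ℤ × ℤ → ℝ) : StarSubalgebra ℂ (LatticeSpace →L[ℂ] LatticeSpace) :=
  (StarAlgebra.adjoin ℂ (Set.range (magneticTranslation B))).topologicalClosure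

theorem magneticTranslation_mem (B : ℤ × ℤ → ℝ) (j : Fin 2) :
    magneticTranslation B j ∈ magneticAlgebra B :=
  StarSubalgebra.le_topologicalClosure _ (StarAlgebra.subset_adjoin ℂ _ (Set.mem_range_self j))

/-- The magnetic translation `s_j` as an element of the magnetic algebra. -/
def magneticGenerator (B : ℤ × ℤ → ℝ) (j : Fin 2) : magneticAlgebra B :=
  ⟨magneticTranslation B j, magneticTranslation_mem B j⟩

/-- An evaluation homomorphism between two magnetic algebras: a surjective `*`-homomorphism that
sends the magnetic translations of the first field to those of the second. -/
structure IsEvaluation {B₁ B₂ : ℤ × ℤ → ℝ}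
    (ev : magneticAlgebra B₁ →⋆ₐ[ℂ] magneticAlgebra B₂) : Prop where
  surjective : Function.Surjective ev
  map_generator : ∀ j, ev (magneticGenerator B₁ j) = magneticGenerator B₂ j

/-- The quarter-plane magnetic field: `bOut` if `n₁ ≤ 0` or `n₂ ≤ 0`, and `bIn` otherwise. -/
def quarterPlaneField (bIn bOut : ℝ) (n : ℤ × ℤ) : ℝ :=
  if n.1 ≤ 0 ∨ n.2 ≤ 0 then bOut else bIn

/-- The limit of the quarter-plane field far to the right (`n₁ → +∞`), a field that is invariant
under translations along `e₁`: `bOut` if `n₂ ≤ 0`, and `bIn` otherwise. -/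
def rightField (bIn bOut : ℝ) (n : ℤ × ℤ) : ℝ :=
  if n.2 ≤ 0 then bOut else bIn

/-- The limit of the quarter-plane field far up (`n₂ → +∞`), a field that is invariant
under translations along `e₂`: `bOut` if `n₁ ≤ 0`, and `bIn` otherwise. -/
def upField (bIn bOut : ℝ) (n : ℤ × ℤ) : ℝ :=
  if n.1 ≤ 0 then bOut else bIn

end

/-!
Translate the quarter-plane field by `(k, 0)` or by `(0, k)`: as `k → ∞` it converges pointwise to
`rightField` or to `upField`. Up to a gauge transformation, these translations asymptotically
intertwine the magnetic translations of the two fields, hence all pairs `(t, t')` in the C⋆-algebra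
generated by the pairs `(𝔰_{B,j}, 𝔰_{B',j})`. This gives `‖t'‖ ≤ ‖t‖`, so that the algebra of pairs
is the graph of the evaluation `t ↦ t'`. Since the translations tend weakly to `0`, it also gives
the invertibility of `t'` whenever `t` is Fredholm.

Conversely, the standard vector potentials of the quarter-plane field and of the right (up) limit
agree outside the second (fourth) quadrant. The magnetic translations being local, an operator in
the kernels of both evaluations is, up to a small norm, supported near the origin, so it is a norm
limit of operators of finite rank. The joint evaluation `(evR, evU)` has closed range, so if its
value at `t` is invertible, then `t` has an inverse modulo such operators and is Fredholm.
-/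

open Filter Topology
open scoped CStarAlgebra ComplexStarModule

section StarHomomorphism

variable {A B : Type*} [CStarAlgebra A] [CStarAlgebra B]

theorem exists_map_eq_norm_le_of_isSelfAdjoint (φ : A →⋆ₐ[ℂ] B) {a : A} (ha : IsSelfAdjoint a) :
    ∃ a' : A, φ a' = φ a ∧ ‖a'‖ ≤ ‖φ a‖ := by
  set M := ‖φ a‖
  let truncation : ℝ → ℝ := fun x => max (-M) (min M x)
  have hM : 0 ≤ M := norm_nonneg _
  have hφa : IsSelfAdjoint (φ a) := ha.map φ
  have truncation_eq : (spectrum ℝ (φ a)).EqOn truncation fun x => x := by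
    intro x hx
    rcases subsingleton_or_nontrivial B with _ | _
    · simp [spectrum.of_subsingleton] at hx
    have hxM : |x| ≤ M := spectrum.norm_le_norm_of_mem hx
    simp [truncation, (abs_le.1 hxM).1, (abs_le.1 hxM).2]
  refine ⟨cfc truncation a, ?_, norm_cfc_le hM fun x _ => ?_⟩
  · rw [StarAlgHom.map_cfc φ truncation a, cfc_congr truncation_eq, cfc_id' ℝ (φ a)]
  · exact abs_le.2 ⟨le_max_left _ _, max_le (by linarith) (min_le_left _ _)⟩

theorem exists_map_eq_norm_le_two_mul (φ : A →⋆ₐ[ℂ] B) (a : A) :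
    ∃ a' : A, φ a' = φ a ∧ ‖a'‖ ≤ 2 * ‖φ a‖ := by
  obtain ⟨x, hx, hx_le⟩ := exists_map_eq_norm_le_of_isSelfAdjoint φ (ℜ a).2
  obtain ⟨y, hy, hy_le⟩ := exists_map_eq_norm_le_of_isSelfAdjoint φ (ℑ a).2
  have map_re : φ (ℜ a : A) = (ℜ (φ a) : B) := by
    simp [realPart_apply_coe, ← Complex.coe_smul, map_star]
  have map_im : φ (ℑ a : A) = (ℑ (φ a) : B) := by
    simp [imaginaryPart_apply_coe, ← Complex.coe_smul, map_star]
  have norm_re : ‖(ℜ (φ a) : B)‖ ≤ ‖φ a‖ := realPart.norm_le (φ a)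
  have norm_im : ‖(ℑ (φ a) : B)‖ ≤ ‖φ a‖ := imaginaryPart.norm_le (φ a)
  refine ⟨x + Complex.I • y, ?_, ?_⟩
  · rw [map_add, map_smul, hx, hy, ← map_smul, ← map_add, realPart_add_I_smul_imaginaryPart]
  · rw [map_re] at hx_le
    rw [map_im] at hy_le
    calc ‖x + Complex.I • y‖ ≤ ‖x‖ + ‖Complex.I • y‖ := norm_add_le _ _
      _ = ‖x‖ + ‖y‖ := by rw [norm_smul, Complex.norm_I, one_mul]
      _ ≤ ‖φ a‖ + ‖φ a‖ :=
        add_le_add (hx_le.trans norm_re) (hy_le.trans norm_im)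
      _ = 2 * ‖φ a‖ := (two_mul _).symm

theorem isClosed_range_starAlgHom (φ : A →⋆ₐ[ℂ] B) : IsClosed (Set.range φ) := by
  let f : NormedAddGroupHom A B :=
    { toFun := φ
      map_add' := map_add φ
      bound' := ⟨1, fun a => by simpa using NonUnitalStarAlgHom.norm_apply_le φ a⟩ }
  have lifts : f.SurjectiveOnWith f.range 2 := by
    rintro _ ⟨a, rfl⟩
    exact exists_map_eq_norm_le_two_mul φ a
  have lifts_closure := controlled_closure_of_complete two_pos one_pos lifts
  refine isClosed_of_closure_subset fun b hb => ?_
  obtain ⟨a, ha, -⟩ := lifts_closure b <| by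
    rwa [← SetLike.mem_coe, AddSubgroup.topologicalClosure_coe]
  exact ⟨a, ha⟩

theorem exists_map_mul_eq_one_of_isUnit_map (φ : A →⋆ₐ[ℂ] B) {a : A} (ha : IsUnit (φ a)) :
    ∃ b : A, φ (b * a) = 1 ∧ φ (a * b) = 1 := by
  have : IsClosed (φ.range : Set B) := isClosed_range_starAlgHom φ
  obtain ⟨⟨_, ⟨_, b, rfl⟩, ab_one, ba_one⟩, rfl⟩ :
      IsUnit (⟨φ a, a, rfl⟩ : φ.range) := (StarSubalgebra.coe_isUnit φ.range).1 ha
  exact ⟨b, by simpa using congrArg Subtype.val ba_one, by simpa using congrArg Subtype.val ab_one⟩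

end StarHomomorphism

section GeneratedAlgebra

variable {A B ι : Type*} [CStarAlgebra A] [CStarAlgebra B]

/-- The unital C⋆-algebra `C*(u i, i : ι)` generated by a family of elements of `A`. -/
noncomputable def generatedCStar (u : ι → A) : StarSubalgebra ℂ A :=
  (StarAlgebra.adjoin ℂ (Set.range u)).topologicalClosure

instance isClosed_generatedCStar (u : ι → A) : IsClosed (generatedCStar u : Set A) :=
  StarSubalgebra.isClosed_topologicalClosure _

theorem mem_generatedCStar (u : ι → A) (i : ι) : u i ∈ generatedCStar u :=
  StarSubalgebra.le_topologicalClosure _ (StarAlgebra.subset_adjoin ℂ _ (Set.mem_range_self i))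

theorem generatedCStar_le {u : ι → A} {S : StarSubalgebra ℂ A} (hS : IsClosed (S : Set A))
    (hu : ∀ i, u i ∈ S) : generatedCStar u ≤ S :=
  StarSubalgebra.topologicalClosure_minimal
    (StarAlgebra.adjoin_le (Set.range_subset_iff.2 hu)) hS

theorem map_generatedCStar (φ : A →⋆ₐ[ℂ] B) (u : ι → A) :
    (generatedCStar u).map φ = generatedCStar fun i => φ (u i) := by
  apply le_antisymm
  · rw [StarSubalgebra.map_le_iff_le_comap]
    exact generatedCStar_le ((isClosed_generatedCStar _).preimage (map_continuous φ))
      (mem_generatedCStar fun i => φ (u i))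
  · refine generatedCStar_le ?_ fun i => ⟨u i, mem_generatedCStar u i, rfl⟩
    convert isClosed_range_starAlgHom (φ.comp (generatedCStar u).subtype)
    ext b
    simp

variable {u : ι → A} {v : ι → B}

/-- The generated algebra of the pairs is the graph of the homomorphism `u i ↦ v i`: the norm
bound makes its first projection injective. -/
theorem exists_surjective_starAlgHom_of_norm_snd_le
    (h : ∀ x ∈ generatedCStar fun i => (u i, v i), ‖x.2‖ ≤ ‖x.1‖) :
    ∃ φ : generatedCStar u →⋆ₐ[ℂ] generatedCStar v, Function.Surjective φ ∧
      ∀ t : generatedCStar u, ((t : A), (φ t : B)) ∈ generatedCStar fun i => (u i, v i) := by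
  set P := generatedCStar fun i => (u i, v i)
  have map_fst : P.map (StarAlgHom.fst ℂ A B) = generatedCStar u := map_generatedCStar _ _
  have map_snd : P.map (StarAlgHom.snd ℂ A B) = generatedCStar v := map_generatedCStar _ _
  let fst : P →⋆ₐ[ℂ] generatedCStar u :=
    ((StarAlgHom.fst ℂ A B).comp P.subtype).codRestrict _ fun x => map_fst ▸ ⟨x, x.2, rfl⟩
  let snd : P →⋆ₐ[ℂ] generatedCStar v :=
    ((StarAlgHom.snd ℂ A B).comp P.subtype).codRestrict _ fun x => map_snd ▸ ⟨x, x.2, rfl⟩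
  have fst_injective : Function.Injective fst := by
    rw [injective_iff_map_eq_zero]
    intro x hx
    have h₁ : x.1.1 = 0 := congrArg Subtype.val hx
    have h₂ : x.1.2 = 0 := norm_le_zero_iff.1 ((h x x.2).trans (by rw [h₁, norm_zero]))
    exact Subtype.ext (Prod.ext h₁ h₂)
  have fst_surjective : Function.Surjective fst := by
    rintro ⟨t, ht⟩
    obtain ⟨x, hx, rfl⟩ := map_fst.ge ht
    exact ⟨⟨x, hx⟩, rfl⟩
  have snd_surjective : Function.Surjective snd := by
    rintro ⟨t, ht⟩
    obtain ⟨x, hx, rfl⟩ := map_snd.ge ht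
    exact ⟨⟨x, hx⟩, rfl⟩
  let e := StarAlgEquiv.ofBijective fst ⟨fst_injective, fst_surjective⟩
  refine ⟨snd.comp (e.symm : generatedCStar u →⋆ₐ[ℂ] P), snd_surjective.comp e.symm.surjective,
    fun t => ?_⟩
  have fst_symm : (e.symm t : A × B).1 = t := congrArg Subtype.val (e.apply_symm_apply t)
  convert (e.symm t).2 using 1
  exact Prod.ext fst_symm.symm rfl

theorem eq_of_pair_mem_generatedCStar (h : ∀ x ∈ generatedCStar fun i => (u i, v i), ‖x.2‖ ≤ ‖x.1‖)
    {a : A} {b b' : B} (hb : (a, b) ∈ generatedCStar fun i => (u i, v i))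
    (hb' : (a, b') ∈ generatedCStar fun i => (u i, v i)) : b = b' := by
  have := h _ (sub_mem hb hb')
  rwa [Prod.mk_sub_mk, sub_self, norm_zero, norm_le_zero_iff, sub_eq_zero] at this

end GeneratedAlgebra

section Fredholm

open scoped LinearMap.FiniteRangeSetoid

variable {𝕜 E : Type*} [NontriviallyNormedField 𝕜] [CompleteSpace 𝕜] [NormedAddCommGroup E]
  [NormedSpace 𝕜 E]

theorem isFredholm_of_comp_left_of_comp_right {a b c : E →L[𝕜] E} (hba : (b * a).IsFredholm)
    (hac : (a * c).IsFredholm) : a.IsFredholm := by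
  obtain ⟨v, v_left, -⟩ := hba.exists_isQuasiInverse
  obtain ⟨w, -, w_right⟩ := hac.exists_isQuasiInverse
  let L : E →ₗ[𝕜] E := (v * b : E →L[𝕜] E)
  let R : E →ₗ[𝕜] E := (c * w : E →L[𝕜] E)
  have left : L.IsLeftQuasiInverse a := v_left
  have right : R.IsRightQuasiInverse a := w_right
  have L_equiv_R : L ≈ R :=
    calc L ≈ L ∘ₗ (a ∘ₗ R) :=
          Setoid.symm (LinearMap.FiniteRangeSetoid.equiv_comp_left right.equiv)
      _ = (L ∘ₗ a) ∘ₗ R := (LinearMap.comp_assoc _ _ _).symm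
      _ ≈ R := LinearMap.FiniteRangeSetoid.equiv_comp_right left.equiv
  exact .of_isQuasiInverse (v := v * b) ⟨left, right.congr L_equiv_R (Setoid.refl _)⟩

/-- An operator is approximable if it is a norm limit of operators of finite rank. On a
Hilbert space these are the compact operators. -/
def IsApproximable (k : E →L[𝕜] E) : Prop :=
  k ∈ closure {F : E →L[𝕜] E | (F : E →ₗ[𝕜] E).HasFiniteRange}

theorem isFredholm_of_isApproximable_sub_one [CompleteSpace E] {a : E →L[𝕜] E}
    (ha : IsApproximable (a - 1)) : a.IsFredholm := by
  obtain ⟨F, hF, dist_lt⟩ := Metric.mem_closure_iff.1 ha 1 one_pos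
  obtain ⟨u, hu⟩ : IsUnit (a - F) := by
    rw [dist_eq_norm, norm_sub_rev] at dist_lt
    convert isUnit_one_sub_of_norm_lt_one dist_lt using 1
    abel
  have equiv_unit : (a : E →ₗ[𝕜] E) ≈ (u : E →L[𝕜] E) := by
    rw [hu, LinearMap.FiniteRangeSetoid.equiv_iff_hasFiniteRange]
    simpa using hF
  have inverse := (ContinuousLinearEquiv.unitsEquiv 𝕜 E u).toLinearEquiv.isQuasiInverse
  exact .of_isQuasiInverse (v := (↑u⁻¹ : E →L[𝕜] E)) (inverse.congr (Setoid.refl _) equiv_unit)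

end Fredholm

section HilbertSpaceOperators

variable {𝕜 H : Type*} [RCLike 𝕜] [NormedAddCommGroup H] [InnerProductSpace 𝕜 H] [CompleteSpace H]

theorem isUnit_of_norm_le_mul_norm {T : H →L[𝕜] H} {c c' : ℝ} (hT : ∀ x, ‖x‖ ≤ c * ‖T x‖)
    (hT' : ∀ x, ‖x‖ ≤ c' * ‖star T x‖) : IsUnit T := by
  rw [ContinuousLinearMap.isUnit_iff_bijective,
    ContinuousLinearMap.bijective_iff_dense_range_and_antilipschitz]
  constructor
  · rw [Submodule.topologicalClosure_eq_top_iff, ContinuousLinearMap.orthogonal_range,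
      Submodule.eq_bot_iff]
    intro x (hx : star T x = 0)
    simpa [hx] using hT' x
  · exact ⟨c.toNNReal, T.antilipschitz_of_bound fun x =>
      (hT x).trans <| mul_le_mul_of_nonneg_right (Real.le_coe_toNNReal c) (norm_nonneg _)⟩

theorem hasFiniteRange_star {F : H →L[𝕜] H} (hF : (F : H →ₗ[𝕜] H).HasFiniteRange) :
    ((star F : H →L[𝕜] H) : H →ₗ[𝕜] H).HasFiniteRange := by
  have : FiniteDimensional 𝕜 (F : H →ₗ[𝕜] H).range := .of_fg hF
  set P := (F : H →ₗ[𝕜] H).range.starProjection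
  have hP : (P : H →ₗ[𝕜] H).HasFiniteRange := by
    rwa [LinearMap.hasFiniteRange_iff_range, Submodule.range_starProjection]
  have P_mul_F : P * F = F := by
    ext x
    exact Submodule.starProjection_eq_self_iff.2 ⟨x, rfl⟩
  have star_F_eq : star F = star F * P := by
    conv_lhs => rw [← P_mul_F, star_mul, (isSelfAdjoint_starProjection _).star_eq]
  rw [star_F_eq]
  exact hP.comp_left _

theorem tendsto_zero_of_hasFiniteRange {ι : Type*} {l : Filter ι} {F : H →L[𝕜] H}
    (hF : (F : H →ₗ[𝕜] H).HasFiniteRange) {u : ι → H}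
    (hu : ∀ y, Tendsto (fun k => inner 𝕜 y (u k)) l (𝓝 0)) :
    Tendsto (fun k => F (u k)) l (𝓝 0) := by
  have : FiniteDimensional 𝕜 (F : H →ₗ[𝕜] H).range := .of_fg hF
  let b := stdOrthonormalBasis 𝕜 (F : H →ₗ[𝕜] H).range
  have F_apply (y : H) : F y = ∑ i, inner 𝕜 (star F (b i : H)) y • (b i : H) := by
    have := congrArg Subtype.val (b.sum_repr' ⟨F y, y, rfl⟩)
    simpa [Submodule.coe_inner, ContinuousLinearMap.star_eq_adjoint,
      ContinuousLinearMap.adjoint_inner_left] using this.symm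
  simp_rw [F_apply]
  simpa using tendsto_finsetSum Finset.univ fun i _ => (hu (star F (b i : H))).smul_const (b i : H)

end HilbertSpaceOperators

section Intertwining

/-- The pair `(x, x')` of operators is asymptotically intertwined by the isometries `W k` along `l`
if `x (W k) - (W k) x'` tends strongly to `0`: far away, as seen through `W k`, the operator `x`
looks like `x'`. -/
def AsymptoticallyIntertwined {ι 𝕜 E : Type*} [NontriviallyNormedField 𝕜] [NormedAddCommGroup E]
    [NormedSpace 𝕜 E] (l : Filter ι) (W : ι → E →ₗᵢ[𝕜] E) (x : (E →L[𝕜] E) × (E →L[𝕜] E)) : Prop :=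
  ∀ ψ, Tendsto (fun k => x.1 (W k ψ) - W k (x.2 ψ)) l (𝓝 0)

namespace AsymptoticallyIntertwined

section NormedSpace

variable {ι 𝕜 E : Type*} [NontriviallyNormedField 𝕜] [NormedAddCommGroup E] [NormedSpace 𝕜 E]
  {l : Filter ι} {W : ι → E →ₗᵢ[𝕜] E} {x y : (E →L[𝕜] E) × (E →L[𝕜] E)}

theorem norm_snd_le_norm_fst [l.NeBot] (hx : AsymptoticallyIntertwined l W x) : ‖x.2‖ ≤ ‖x.1‖ := by
  refine x.2.opNorm_le_bound (norm_nonneg _) fun ψ => ?_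
  have limit : Tendsto (fun k => ‖x.1‖ * ‖ψ‖ + ‖x.1 (W k ψ) - W k (x.2 ψ)‖) l
      (𝓝 (‖x.1‖ * ‖ψ‖)) := by
    simpa using (hx ψ).norm.const_add (‖x.1‖ * ‖ψ‖)
  refine ge_of_tendsto' limit fun k => ?_
  calc ‖x.2 ψ‖ = ‖W k (x.2 ψ)‖ := ((W k).norm_map _).symm
    _ ≤ ‖x.1 (W k ψ)‖ + ‖x.1 (W k ψ) - W k (x.2 ψ)‖ := norm_le_norm_add_norm_sub _ _
    _ ≤ ‖x.1‖ * ‖ψ‖ + ‖x.1 (W k ψ) - W k (x.2 ψ)‖ := by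
      gcongr
      simpa using x.1.le_opNorm (W k ψ)

theorem algebraMap (c : 𝕜) :
    AsymptoticallyIntertwined l W (algebraMap 𝕜 ((E →L[𝕜] E) × (E →L[𝕜] E)) c) := by
  intro ψ
  simpa [Algebra.algebraMap_eq_smul_one] using tendsto_const_nhds

theorem add (hx : AsymptoticallyIntertwined l W x) (hy : AsymptoticallyIntertwined l W y) :
    AsymptoticallyIntertwined l W (x + y) := by
  intro ψ
  have := (hx ψ).add (hy ψ)
  rw [add_zero] at this
  refine this.congr fun k => ?_
  simp only [Prod.fst_add, Prod.snd_add, add_apply, map_add]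
  abel

theorem mul (hx : AsymptoticallyIntertwined l W x) (hy : AsymptoticallyIntertwined l W y) :
    AsymptoticallyIntertwined l W (x * y) := by
  intro ψ
  have := ((x.1.continuous.tendsto 0).comp (hy ψ)).add (hx (y.2 ψ))
  rw [map_zero, add_zero] at this
  refine this.congr fun k => ?_
  simp only [Function.comp_apply, Prod.fst_mul, Prod.snd_mul, map_sub]
  exact sub_add_sub_cancel _ _ _

variable (l W) in
theorem isClosed_setOf : IsClosed {x | AsymptoticallyIntertwined l W x} := by
  simp only [AsymptoticallyIntertwined, Set.ofPred_forall]
  refine isClosed_iInter fun ψ => ?_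
  let defect (k : ι) (x : (E →L[𝕜] E) × (E →L[𝕜] E)) : E := x.1 (W k ψ) - W k (x.2 ψ)
  have lipschitz (k : ι) : LipschitzWith (‖ψ‖₊ + ‖ψ‖₊) (defect k) := by
    refine LipschitzWith.of_dist_le_mul fun x y => ?_
    rw [dist_eq_norm, dist_eq_norm]
    calc ‖defect k x - defect k y‖ = ‖(x - y).1 (W k ψ) - W k ((x - y).2 ψ)‖ := by
          simp only [defect, Prod.fst_sub, Prod.snd_sub, sub_apply, map_sub]
          rw [sub_sub_sub_comm]
      _ ≤ ‖(x - y).1‖ * ‖W k ψ‖ + ‖(x - y).2‖ * ‖ψ‖ := by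
          refine (norm_sub_le _ _).trans (add_le_add ((x - y).1.le_opNorm _) ?_)
          rw [(W k).norm_map]
          exact (x - y).2.le_opNorm ψ
      _ ≤ ‖x - y‖ * ‖ψ‖ + ‖x - y‖ * ‖ψ‖ := by
          rw [(W k).norm_map]
          gcongr
          exacts [norm_fst_le _, norm_snd_le _]
      _ = ↑(‖ψ‖₊ + ‖ψ‖₊) * ‖x - y‖ := by
          rw [NNReal.coe_add, coe_nnnorm]
          ring
  exact (LipschitzWith.uniformEquicontinuous defect _ lipschitz).equicontinuous
    |>.isClosed_setOfPred_tendsto continuous_const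

end NormedSpace

section HilbertSpace

variable {ι 𝕜 H : Type*} [RCLike 𝕜] [NormedAddCommGroup H] [InnerProductSpace 𝕜 H]
  [CompleteSpace H] {l : Filter ι} {W : ι → H →ₗᵢ[𝕜] H} {x : (H →L[𝕜] H) × (H →L[𝕜] H)}

/-- For unitary `x.1` and `x.2`, we have `x.1⋆ W - W x.2⋆ = -x.1⋆ (x.1 W - W x.2) x.2⋆`. -/
theorem star_of_mem_unitary (hx : AsymptoticallyIntertwined l W x)
    (unitary_x : x ∈ unitary ((H →L[𝕜] H) × (H →L[𝕜] H))) :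
    AsymptoticallyIntertwined l W (star x) := by
  intro ψ
  have := (((star x.1).continuous.tendsto 0).comp (hx (star x.2 ψ))).neg
  rw [map_zero, neg_zero] at this
  have star_mul_fst (φ : H) : star x.1 (x.1 φ) = φ :=
    DFunLike.congr_fun (congrArg Prod.fst (Unitary.star_mul_self_of_mem unitary_x)) φ
  have mul_star_snd (φ : H) : x.2 (star x.2 φ) = φ :=
    DFunLike.congr_fun (congrArg Prod.snd (Unitary.mul_star_self_of_mem unitary_x)) φ
  refine this.congr fun k => ?_
  simp only [Function.comp_apply, map_sub, star_mul_fst, mul_star_snd, neg_sub, Prod.fst_star,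
    Prod.snd_star]

theorem norm_le_of_hasFiniteRange [l.NeBot] (hx : AsymptoticallyIntertwined l W x)
    (weakly_null : ∀ φ ψ, Tendsto (fun k => inner 𝕜 φ (W k ψ)) l (𝓝 0)) {v : H →L[𝕜] H}
    (hv : ((v * x.1 - 1 : H →L[𝕜] H) : H →ₗ[𝕜] H).HasFiniteRange) (ψ : H) :
    ‖ψ‖ ≤ ‖v‖ * ‖x.2 ψ‖ := by
  have finite_rank_part := tendsto_zero_of_hasFiniteRange hv fun φ => weakly_null φ ψ
  have limit := (((hx ψ).norm.const_mul ‖v‖).add finite_rank_part.norm).const_add (‖v‖ * ‖x.2 ψ‖)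
  simp only [norm_zero, mul_zero, add_zero] at limit
  refine ge_of_tendsto' limit fun k => ?_
  calc ‖ψ‖ = ‖W k ψ‖ := ((W k).norm_map _).symm
    _ = ‖v (W k (x.2 ψ)) + (v (x.1 (W k ψ) - W k (x.2 ψ)) - (v * x.1 - 1) (W k ψ))‖ := by
      congr 1
      simp only [sub_apply, map_sub, one_apply_eq_self, mul_apply_eq_comp]
      abel
    _ ≤ ‖v (W k (x.2 ψ))‖ + (‖v (x.1 (W k ψ) - W k (x.2 ψ))‖ + ‖(v * x.1 - 1) (W k ψ)‖) :=
      (norm_add_le _ _).trans (by gcongr; exact norm_sub_le _ _)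
    _ ≤ ‖v‖ * ‖x.2 ψ‖ + (‖v‖ * ‖x.1 (W k ψ) - W k (x.2 ψ)‖ + ‖(v * x.1 - 1) (W k ψ)‖) := by
      gcongr
      · simpa using v.le_opNorm (W k (x.2 ψ))
      · exact v.le_opNorm _

theorem isUnit_snd_of_isFredholm_fst [l.NeBot] (hx : AsymptoticallyIntertwined l W x)
    (hx' : AsymptoticallyIntertwined l W (star x))
    (weakly_null : ∀ φ ψ, Tendsto (fun k => inner 𝕜 φ (W k ψ)) l (𝓝 0))
    (fredholm : x.1.IsFredholm) : IsUnit x.2 := by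
  obtain ⟨v, v_left, v_right⟩ := fredholm.exists_isQuasiInverse
  have left : ((v * x.1 - 1 : H →L[𝕜] H) : H →ₗ[𝕜] H).HasFiniteRange :=
    LinearMap.FiniteRangeSetoid.equiv_iff_hasFiniteRange.1 v_left
  have right : ((x.1 * v - 1 : H →L[𝕜] H) : H →ₗ[𝕜] H).HasFiniteRange :=
    LinearMap.FiniteRangeSetoid.equiv_iff_hasFiniteRange.1 v_right
  have star_right := hasFiniteRange_star right
  rw [star_sub, star_mul, star_one] at star_right
  exact isUnit_of_norm_le_mul_norm (hx.norm_le_of_hasFiniteRange weakly_null left)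
    (hx'.norm_le_of_hasFiniteRange weakly_null star_right)

end HilbertSpace

theorem of_mem_generatedCStar {ι κ H : Type*} [NormedAddCommGroup H] [InnerProductSpace ℂ H]
    [CompleteSpace H] {l : Filter ι} {W : ι → H →ₗᵢ[ℂ] H} {x : (H →L[ℂ] H) × (H →L[ℂ] H)}
    {u : κ → (H →L[ℂ] H) × (H →L[ℂ] H)} (hu : ∀ i, AsymptoticallyIntertwined l W (u i))
    (unitary_u : ∀ i, u i ∈ unitary ((H →L[ℂ] H) × (H →L[ℂ] H)))
    (hx : x ∈ generatedCStar u) : AsymptoticallyIntertwined l W x := by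
  refine closure_minimal (fun y hy => ?_) (isClosed_setOf l W) hx
  rw [SetLike.mem_coe, ← StarSubalgebra.mem_toSubalgebra, StarAlgebra.adjoin_toSubalgebra] at hy
  induction hy using Algebra.adjoin_induction with
  | mem y hy =>
    rcases hy with ⟨i, rfl⟩ | ⟨i, hi⟩
    · exact hu i
    · rw [← star_star y, ← hi]
      exact (hu i).star_of_mem_unitary (unitary_u i)
  | algebraMap c => exact algebraMap c
  | add _ _ _ _ h h' => exact h.add h'
  | mul _ _ _ _ h h' => exact h.mul h'

end AsymptoticallyIntertwined

end Intertwining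

section SequenceSpaces

open scoped NNReal ENNReal

theorem tendsto_zero_of_forall_single {ι κ 𝕜 F : Type*} [NontriviallyNormedField 𝕜]
    {E : κ → Type*} [∀ i, NormedAddCommGroup (E i)] [∀ i, NormedSpace 𝕜 (E i)]
    [NormedAddCommGroup F] [NormedSpace 𝕜 F] [DecidableEq κ] {p : ℝ≥0∞} [Fact (1 ≤ p)]
    (hp : p ≠ ∞) {l : Filter ι} {T : ι → lp E p →L[𝕜] F} {C : ℝ≥0} (norm_le : ∀ k, ‖T k‖₊ ≤ C)
    (single : ∀ i a, Tendsto (fun k => T k (lp.single p i a)) l (𝓝 0)) (ψ : lp E p) :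
    Tendsto (fun k => T k ψ) l (𝓝 0) := by
  have closed : IsClosed {ψ | Tendsto (fun k => T k ψ) l (𝓝 0)} :=
    (LipschitzWith.uniformEquicontinuous (fun k => T k) C fun k =>
      (T k).lipschitz.weaken (norm_le k)).equicontinuous.isClosed_setOfPred_tendsto
      continuous_const
  refine closed.mem_of_tendsto (lp.hasSum_single hp ψ) (.of_forall fun s => ?_)
  simpa [map_sum] using tendsto_finsetSum s fun i _ => single i (ψ i)

theorem tendsto_inner_of_tendsto_apply {ι κ 𝕜 : Type*} [RCLike 𝕜] {E : κ → Type*}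
    [∀ i, NormedAddCommGroup (E i)] [∀ i, InnerProductSpace 𝕜 (E i)] {l : Filter ι}
    {u : ι → lp E 2} {C : ℝ≥0} (norm_le : ∀ k, ‖u k‖₊ ≤ C)
    (coordinates : ∀ i, Tendsto (fun k => u k i) l (𝓝 0)) (φ : lp E 2) :
    Tendsto (fun k => inner 𝕜 φ (u k)) l (𝓝 0) := by
  classical
  rw [tendsto_zero_iff_norm_tendsto_zero]
  simp_rw [norm_inner_symm φ]
  rw [← tendsto_zero_iff_norm_tendsto_zero]
  refine tendsto_zero_of_forall_single (T := fun k => innerSL 𝕜 (u k)) (by simp) (C := C)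
    (fun k => ?_) (fun i a => ?_) φ
  · rw [← NNReal.coe_le_coe, coe_nnnorm, innerSL_apply_norm]
    exact norm_le k
  · simpa [lp.inner_single_right] using (coordinates i).inner tendsto_const_nhds

variable {X 𝕜 E : Type*} [NontriviallyNormedField 𝕜] [NormedAddCommGroup E] [NormedSpace 𝕜 E]
  {p : ℝ≥0∞} [Fact (1 ≤ p)]

variable (𝕜 E p) in
/-- The multiplication by the indicator function of `S`, as an operator on `ℓᵖ(X, E)`. -/
noncomputable def lpIndicator (S : Set X) : lp (fun _ : X => E) p →L[𝕜] lp (fun _ : X => E) p :=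
  LinearMap.mkContinuous
    { toFun := fun ψ => ⟨S.indicator ψ, (lp.memℓp ψ).mono' (norm_indicator_le_norm_self ψ)⟩
      map_add' := fun ψ φ => lp.ext (S.indicator_add ψ φ)
      map_smul' := fun c ψ => lp.ext (S.indicator_const_smul c ψ) }
    1 fun ψ => by
      rw [one_mul]
      exact lp.norm_mono (zero_lt_one.trans_le Fact.out).ne' (norm_indicator_le_norm_self ψ)

theorem norm_lpIndicator_le (S : Set X) : ‖lpIndicator 𝕜 E p S‖ ≤ 1 :=
  LinearMap.mkContinuous_norm_le _ zero_le_one _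

theorem hasFiniteRange_lpIndicator [FiniteDimensional 𝕜 E] {S : Set X}
    (hS : S.Finite) :
    (lpIndicator 𝕜 E p S : lp (fun _ : X => E) p →ₗ[𝕜] lp (fun _ : X => E) p).HasFiniteRange := by
  classical
  let restrict : lp (fun _ : X => E) p →ₗ[𝕜] hS.toFinset → E :=
    LinearMap.pi fun i => (lp.evalCLM 𝕜 (fun _ : X => E) p (i : X)).toLinearMap
  let extend : (hS.toFinset → E) →ₗ[𝕜] lp (fun _ : X => E) p :=
    ∑ i : hS.toFinset, (lp.singleContinuousLinearMap 𝕜 (fun _ : X => E) p i).toLinearMap ∘ₗ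
      LinearMap.proj i
  have factorization : (lpIndicator 𝕜 E p S : _ →ₗ[𝕜] _) = extend ∘ₗ restrict := by
    ext ψ n
    have extend_restrict : extend (restrict ψ) = ∑ i ∈ hS.toFinset, lp.single p i (ψ i) := by
      simp only [extend, restrict, LinearMap.sum_apply]
      exact Finset.sum_coe_sort hS.toFinset fun i => (lp.single p i (ψ i) : lp (fun _ : X => E) p)
    rw [LinearMap.comp_apply, extend_restrict, lp.coeFn_sum, Finset.sum_apply]
    change S.indicator ψ n = _
    simp [lp.single_apply, Pi.single_apply, Set.indicator_apply]
  rw [factorization]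
  exact LinearMap.HasFiniteRange.of_isNoetherian_rng.comp_left extend

theorem norm_sub_lpIndicator_compl_mul_le (S T : Set X)
    (k : lp (fun _ : X => E) p →L[𝕜] lp (fun _ : X => E) p) :
    ‖k - lpIndicator 𝕜 E p (S ∪ T)ᶜ * k‖ ≤
      ‖lpIndicator 𝕜 E p S * k‖ + ‖lpIndicator 𝕜 E p T * k‖ := by
  have decomposition : k - lpIndicator 𝕜 E p (S ∪ T)ᶜ * k =
      lpIndicator 𝕜 E p S * k + lpIndicator 𝕜 E p Sᶜ * (lpIndicator 𝕜 E p T * k) := by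
    ext ψ n
    change k ψ n - (S ∪ T)ᶜ.indicator (k ψ) n =
      S.indicator (k ψ) n + Sᶜ.indicator (T.indicator (k ψ)) n
    by_cases hS : n ∈ S <;> by_cases hT : n ∈ T <;> simp [hS, hT]
  rw [decomposition]
  exact (norm_add_le _ _).trans <| add_le_add_right
    ((norm_mul_le _ _).trans <| mul_le_of_le_one_left (norm_nonneg _) (norm_lpIndicator_le _)) _

end SequenceSpaces

section Locality

open scoped NNReal ENNReal

variable {X 𝕜 E : Type*} [PseudoMetricSpace X] [NontriviallyNormedField 𝕜] [NormedAddCommGroup E]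
  [NormedSpace 𝕜 E] {p : ℝ≥0∞} [Fact (1 ≤ p)]

/-- The points of `S` at distance more than `r` from every point outside `S`. -/
def erosion (S : Set X) (r : ℝ≥0) : Set X :=
  {n | Metric.closedBall n r ⊆ S}

theorem erosion_antitone (S : Set X) : Antitone (erosion S) := fun _ _ hrs _ hn =>
  (Metric.closedBall_subset_closedBall (NNReal.coe_le_coe.2 hrs)).trans hn

/-- The two operators of the pair `x` have finite propagation `r` and coincide deep inside `S`:
at points of depth `r`, they act in the same way on functions that agree up to distance `r`. -/
def CoincideDeepInside (S : Set X)
    (x : (lp (fun _ : X => E) p →L[𝕜] lp (fun _ : X => E) p) ×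
      (lp (fun _ : X => E) p →L[𝕜] lp (fun _ : X => E) p)) : Prop :=
  ∃ r : ℝ≥0, ∀ n ∈ erosion S r, ∀ ψ φ : lp (fun _ : X => E) p,
    (∀ m ∈ Metric.closedBall n r, ψ m = φ m) → x.1 ψ n = x.2 φ n

variable {S T : Set X}

namespace CoincideDeepInside

variable {x y : (lp (fun _ : X => E) p →L[𝕜] lp (fun _ : X => E) p) ×
  (lp (fun _ : X => E) p →L[𝕜] lp (fun _ : X => E) p)}

theorem algebraMap (c : 𝕜) : CoincideDeepInside S
    (algebraMap 𝕜 ((lp (fun _ : X => E) p →L[𝕜] lp (fun _ : X => E) p) ×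
      (lp (fun _ : X => E) p →L[𝕜] lp (fun _ : X => E) p)) c) :=
  ⟨0, fun n _ _ _ h => congrArg (c • ·) (h n (Metric.mem_closedBall_self (by simp)))⟩

theorem add (hx : CoincideDeepInside S x) (hy : CoincideDeepInside S y) :
    CoincideDeepInside S (x + y) := by
  obtain ⟨r, hr⟩ := hx
  obtain ⟨r', hr'⟩ := hy
  have subset (n : X) := Metric.closedBall_subset_closedBall (x := n)
    (NNReal.coe_le_coe.2 (le_max_left r r'))
  have subset' (n : X) := Metric.closedBall_subset_closedBall (x := n)
    (NNReal.coe_le_coe.2 (le_max_right r r'))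
  exact ⟨max r r', fun n hn ψ φ h => congrArg₂ (· + ·)
    (hr n ((subset n).trans hn) ψ φ fun m hm => h m (subset n hm))
    (hr' n ((subset' n).trans hn) ψ φ fun m hm => h m (subset' n hm))⟩

theorem mul (hx : CoincideDeepInside S x) (hy : CoincideDeepInside S y) :
    CoincideDeepInside S (x * y) := by
  obtain ⟨r, hr⟩ := hx
  obtain ⟨r', hr'⟩ := hy
  refine ⟨r + r', fun n hn ψ φ h => ?_⟩
  refine hr n (erosion_antitone S le_self_add hn) (y.1 ψ) (y.2 φ) fun m hm => ?_
  have subset : Metric.closedBall m r' ⊆ Metric.closedBall n ↑(r + r') :=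
    Metric.closedBall_subset_closedBall' <| by
      rw [NNReal.coe_add, add_comm]
      exact add_le_add_left hm _
  exact hr' m (subset.trans hn) ψ φ fun i hi => h i (subset hi)

end CoincideDeepInside

theorem eventually_norm_lpIndicator_erosion_mul_lt
    {x : (lp (fun _ : X => E) p →L[𝕜] lp (fun _ : X => E) p) ×
      (lp (fun _ : X => E) p →L[𝕜] lp (fun _ : X => E) p)}
    (hx : x ∈ closure {y | CoincideDeepInside S y}) {ε : ℝ} (hε : 0 < ε) :
    ∀ᶠ s in atTop, ‖lpIndicator 𝕜 E p (erosion S s) * (x.1 - x.2)‖ < ε := by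
  obtain ⟨y, ⟨r, hr⟩, hxy⟩ := Metric.mem_closure_iff.1 hx (ε / 2) (half_pos hε)
  rw [dist_eq_norm] at hxy
  filter_upwards [eventually_ge_atTop r] with s hrs
  have vanishes : lpIndicator 𝕜 E p (erosion S s) * (y.1 - y.2) = 0 := by
    ext ψ n
    change (erosion S s).indicator ((y.1 - y.2) ψ) n = 0
    exact Set.indicator_apply_eq_zero.2 fun hn =>
      sub_eq_zero.2 (hr n (erosion_antitone S hrs hn) ψ ψ fun _ _ => rfl)
  calc ‖lpIndicator 𝕜 E p (erosion S s) * (x.1 - x.2)‖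
      = ‖lpIndicator 𝕜 E p (erosion S s) * ((x - y).1 - (x - y).2)‖ := by
        rw [← sub_zero (_ * (x.1 - x.2)), ← vanishes, ← mul_sub, Prod.fst_sub, Prod.snd_sub,
          sub_sub_sub_comm]
    _ ≤ ‖lpIndicator 𝕜 E p (erosion S s)‖ * ‖(x - y).1 - (x - y).2‖ := norm_mul_le _ _
    _ ≤ ‖(x - y).1 - (x - y).2‖ :=
      mul_le_of_le_one_left (norm_nonneg _) (norm_lpIndicator_le _)
    _ ≤ ‖(x - y).1‖ + ‖(x - y).2‖ := norm_sub_le _ _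
    _ ≤ ‖x - y‖ + ‖x - y‖ := add_le_add (norm_fst_le _) (norm_snd_le _)
    _ < ε := by linarith

theorem isApproximable_of_mem_closure_coincideDeepInside [FiniteDimensional 𝕜 E]
    {k : lp (fun _ : X => E) p →L[𝕜] lp (fun _ : X => E) p}
    (finite : ∀ s, (erosion S s ∪ erosion T s)ᶜ.Finite)
    (hS : (k, 0) ∈ closure {y | CoincideDeepInside S y})
    (hT : (k, 0) ∈ closure {y | CoincideDeepInside T y}) : IsApproximable k := by
  refine Metric.mem_closure_iff.2 fun ε hε => ?_
  obtain ⟨s, norm_S, norm_T⟩ := ((eventually_norm_lpIndicator_erosion_mul_lt hS (half_pos hε)).and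
    (eventually_norm_lpIndicator_erosion_mul_lt hT (half_pos hε))).exists
  rw [sub_zero] at norm_S norm_T
  refine ⟨lpIndicator 𝕜 E p (erosion S s ∪ erosion T s)ᶜ * k,
    (hasFiniteRange_lpIndicator (finite s)).comp_right _, ?_⟩
  rw [dist_eq_norm]
  exact (norm_sub_lpIndicator_compl_mul_le _ _ k).trans_lt (by linarith)

end Locality

section WeightedTranslations

open scoped NNReal

theorem weightedTranslationIsometry_apply (θ : ℤ × ℤ → ℝ) (e : ℤ × ℤ) (ψ : LatticeSpace)
    (n : ℤ × ℤ) :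
    weightedTranslationIsometry θ e ψ n = Complex.exp (Complex.I * (θ n : ℂ)) * ψ (n - e) :=
  rfl

theorem weightedTranslationIsometry_single (θ : ℤ × ℤ → ℝ) (e n : ℤ × ℤ) (a : ℂ) :
    weightedTranslationIsometry θ e (lp.single 2 n a) =
      lp.single 2 (n + e) (Complex.exp (Complex.I * (θ (n + e) : ℂ)) * a) := by
  ext m
  rw [weightedTranslationIsometry_apply, lp.single_apply, lp.single_apply]
  by_cases hm : m = n + e
  · subst hm
    simp
  · simp [hm, sub_eq_iff_eq_add]

theorem weightedTranslationIsometry_comp_inverse (θ : ℤ × ℤ → ℝ) (e : ℤ × ℤ) :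
    (weightedTranslationIsometry θ e).toContinuousLinearMap *
      (weightedTranslationIsometry (fun n => -θ (n + e)) (-e)).toContinuousLinearMap = 1 := by
  ext ψ n
  change Complex.exp (Complex.I * (θ n : ℂ)) *
    (Complex.exp (Complex.I * ((-θ (n - e + e) : ℝ) : ℂ)) * ψ (n - e - -e)) = ψ n
  rw [sub_add_cancel, sub_neg_eq_add, sub_add_cancel, ← mul_assoc, ← Complex.exp_add]
  simp

theorem star_weightedTranslationIsometry_mul_self (θ : ℤ × ℤ → ℝ) (e : ℤ × ℤ) :
    star (weightedTranslationIsometry θ e).toContinuousLinearMap *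
      (weightedTranslationIsometry θ e).toContinuousLinearMap = 1 :=
  (ContinuousLinearMap.norm_map_iff_adjoint_comp_self _).1
    (weightedTranslationIsometry θ e).norm_map

theorem star_weightedTranslationIsometry (θ : ℤ × ℤ → ℝ) (e : ℤ × ℤ) :
    star (weightedTranslationIsometry θ e).toContinuousLinearMap =
      (weightedTranslationIsometry (fun n => -θ (n + e)) (-e)).toContinuousLinearMap :=
  left_inv_eq_right_inv (star_weightedTranslationIsometry_mul_self θ e)
    (weightedTranslationIsometry_comp_inverse θ e)

theorem weightedTranslationIsometry_mem_unitary (θ : ℤ × ℤ → ℝ) (e : ℤ × ℤ) :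
    (weightedTranslationIsometry θ e).toContinuousLinearMap ∈
      unitary (LatticeSpace →L[ℂ] LatticeSpace) := by
  refine Unitary.mem_iff.2 ⟨star_weightedTranslationIsometry_mul_self θ e, ?_⟩
  rw [star_weightedTranslationIsometry]
  exact weightedTranslationIsometry_comp_inverse θ e

variable {ι : Type*} {l : Filter ι} {η : ι → ℤ × ℤ → ℝ} {h : ι → ℤ × ℤ}

theorem tendsto_apply_cofinite_latticeSpace (ψ : LatticeSpace) : Tendsto ψ cofinite (𝓝 0) := by
  have summable : Summable fun n => ‖ψ n‖ ^ 2 := by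
    simpa using (lp.memℓp ψ).summable (p := 2) (by norm_num)
  rw [tendsto_zero_iff_norm_tendsto_zero]
  simpa using summable.tendsto_cofinite_zero.sqrt

theorem tendsto_inner_weightedTranslationIsometry (hh : Tendsto h l cofinite)
    (φ ψ : LatticeSpace) :
    Tendsto (fun k => inner ℂ φ (weightedTranslationIsometry (η k) (h k) ψ)) l (𝓝 0) := by
  refine tendsto_inner_of_tendsto_apply (C := ‖ψ‖₊)
    (fun k => ((weightedTranslationIsometry (η k) (h k)).nnnorm_map ψ).le) (fun n => ?_) φ
  have translates : Tendsto (fun k => ψ (n - h k)) l (𝓝 0) :=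
    (tendsto_apply_cofinite_latticeSpace ψ).comp
      ((Equiv.subLeft n).injective.tendsto_cofinite.comp hh)
  rw [tendsto_zero_iff_norm_tendsto_zero] at translates ⊢
  simpa [weightedTranslationIsometry_apply, mul_comm Complex.I,
    Complex.norm_exp_ofReal_mul_I] using translates

theorem asymptoticallyIntertwined_weightedTranslationIsometry {θ θ' : ℤ × ℤ → ℝ} {e : ℤ × ℤ}
    (gauge : ∀ m, ∀ᶠ k in l, θ (m + h k) + η k (m + h k - e) = η k (m + h k) + θ' m) :
    AsymptoticallyIntertwined l (fun k => weightedTranslationIsometry (η k) (h k))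
      ((weightedTranslationIsometry θ e).toContinuousLinearMap,
        (weightedTranslationIsometry θ' e).toContinuousLinearMap) := by
  let W (k : ι) := (weightedTranslationIsometry (η k) (h k)).toContinuousLinearMap
  let defect (k : ι) : LatticeSpace →L[ℂ] LatticeSpace :=
    (weightedTranslationIsometry θ e).toContinuousLinearMap * W k -
      W k * (weightedTranslationIsometry θ' e).toContinuousLinearMap
  have norm_le_one (T : LatticeSpace →ₗᵢ[ℂ] LatticeSpace) : ‖T.toContinuousLinearMap‖₊ ≤ 1 :=
    T.norm_toContinuousLinearMap_le
  have norm_defect_le (k : ι) : ‖defect k‖₊ ≤ 1 * 1 + 1 * 1 :=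
    (nnnorm_sub_le _ _).trans <| add_le_add
      ((nnnorm_mul_le _ _).trans (mul_le_mul' (norm_le_one _) (norm_le_one _)))
      ((nnnorm_mul_le _ _).trans (mul_le_mul' (norm_le_one _) (norm_le_one _)))
  refine tendsto_zero_of_forall_single (T := defect) (by simp) norm_defect_le fun n a => ?_
  refine tendsto_const_nhds.congr' ?_
  filter_upwards [gauge (n + e)] with k hk
  have position : n + h k + e = n + e + h k := add_right_comm _ _ _
  have position' : n + e + h k - e = n + h k := by rw [← position, add_sub_cancel_right]
  rw [position'] at hk
  change 0 = weightedTranslationIsometry θ e (weightedTranslationIsometry (η k) (h k) _) -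
    weightedTranslationIsometry (η k) (h k) (weightedTranslationIsometry θ' e _)
  simp only [weightedTranslationIsometry_single, position]
  rw [← mul_assoc, ← mul_assoc, ← Complex.exp_add, ← Complex.exp_add, ← mul_add, ← mul_add,
    ← Complex.ofReal_add, ← Complex.ofReal_add, hk, sub_self]

end WeightedTranslations

section SignedSum

open Finset (Ioc)

/-- The sum `f 1 + ⋯ + f n` for `n ≥ 0`, continued to `-(f (n + 1) + ⋯ + f 0)` for `n ≤ 0`: the
discrete analogue of the integral of `f` from `0` to `n`. -/
noncomputable def signedSum {M : Type*} [AddCommGroup M] (f : ℤ → M) (n : ℤ) : M :=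
  ∑ m ∈ Ioc 0 n, f m - ∑ m ∈ Ioc n 0, f m

variable {M : Type*} [AddCommGroup M]

theorem signedSum_congr {f g : ℤ → M} {n : ℤ} (h : ∀ m ∈ Set.uIoc 0 n, f m = g m) :
    signedSum f n = signedSum g n :=
  congrArg₂ (· - ·)
    (Finset.sum_congr rfl fun m hm => h m (Set.mem_uIoc.2 (.inl (Finset.mem_Ioc.1 hm))))
    (Finset.sum_congr rfl fun m hm => h m (Set.mem_uIoc.2 (.inr (Finset.mem_Ioc.1 hm))))

theorem signedSum_zero (f : ℤ → M) : signedSum f 0 = 0 := by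
  simp [signedSum]

theorem signedSum_add_one (f : ℤ → M) (n : ℤ) :
    signedSum f (n + 1) = signedSum f n + f (n + 1) := by
  rw [signedSum, signedSum]
  rcases lt_or_ge n 0 with hn | hn
  · have split_Ioc : insert (n + 1) (Ioc (n + 1) 0) = Ioc n 0 := by grind
    rw [← split_Ioc, Finset.sum_insert (by simp), Finset.Ioc_eq_empty_of_le hn.le,
      Finset.Ioc_eq_empty_of_le (Int.add_one_le_of_lt hn)]
    abel
  · have split_Ioc : insert (n + 1) (Ioc 0 n) = Ioc 0 (n + 1) := by grind
    rw [← split_Ioc, Finset.sum_insert (by simp), Finset.Ioc_eq_empty_of_le hn,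
      Finset.Ioc_eq_empty_of_le (by lia : 0 ≤ n + 1)]
    abel

theorem signedSum_add (f : ℤ → M) (a b : ℤ) :
    signedSum f (a + b) = signedSum f b + signedSum (fun m => f (m + b)) a := by
  have step (a : ℤ) := signedSum_add_one (fun m => f (m + b)) a
  have step' (a : ℤ) := signedSum_add_one f (a + b)
  induction a using Int.induction_on with
  | zero => simp [signedSum_zero]
  | succ a ih =>
    rw [step, add_right_comm, step', ih, add_assoc, add_right_comm]
  | pred a ih =>
    have h := step (-a - 1)
    have h' := step' (-a - 1)
    rw [sub_add_cancel] at h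
    rw [add_right_comm, sub_add_cancel] at h'
    exact add_right_cancel ((h'.symm.trans ih).trans (by rw [h, add_assoc]))

end SignedSum

section VectorPotential

variable {B B' : ℤ × ℤ → ℝ}

theorem vectorPotential_zero (B : ℤ × ℤ → ℝ) (n : ℤ × ℤ) :
    vectorPotential B 0 n = signedSum (fun m => B (n.1, m)) n.2 := by
  have positive : (if 0 < n.2 then ∑ m ∈ Finset.Icc 1 n.2, B (n.1, m) else 0) =
      ∑ m ∈ Finset.Ioc 0 n.2, B (n.1, m) := by
    split_ifs with h
    · exact Finset.sum_congr (by grind) fun _ _ => rfl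
    · rw [Finset.Ioc_eq_empty h, Finset.sum_empty]
  have negative : (if n.2 < 0 then ∑ m ∈ Finset.Icc 0 (|n.2| - 1), B (n.1, -m) else 0) =
      ∑ m ∈ Finset.Ioc n.2 0, B (n.1, m) := by
    split_ifs with h
    · refine Finset.sum_nbij (- ·) (fun m hm => ?_) neg_injective.injOn (fun m hm => ?_)
        fun _ _ => rfl
      · rw [Finset.mem_Icc, abs_of_neg h] at hm
        exact Finset.mem_Ioc.2 (by lia)
      · rw [Finset.mem_coe, Finset.mem_Ioc] at hm
        refine ⟨-m, Finset.mem_coe.2 (Finset.mem_Icc.2 ?_), neg_neg m⟩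
        rw [abs_of_neg h]
        lia
    · rw [Finset.Ioc_eq_empty h, Finset.sum_empty]
  rw [vectorPotential, if_pos rfl, positive, negative, signedSum]

theorem vectorPotential_one (B : ℤ × ℤ → ℝ) (n : ℤ × ℤ) : vectorPotential B 1 n = 0 := by
  simp [vectorPotential]

theorem vectorPotential_congr {n : ℤ × ℤ} (h : ∀ m ∈ Set.uIoc 0 n.2, B (n.1, m) = B' (n.1, m))
    (j : Fin 2) : vectorPotential B j n = vectorPotential B' j n := by
  fin_cases j
  · exact (vectorPotential_zero B n).trans <|
      (signedSum_congr h).trans (vectorPotential_zero B' n).symm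
  · exact (vectorPotential_one B n).trans (vectorPotential_one B' n).symm

/-- The gauge transformation that turns the vector potential of `B` into the translate by `h` of the
vector potential of `m ↦ B (m + h)`: the two differ by `n ↦ A_B((n₁, h₂), (n₁ - 1, h₂))`, which only
depends on the first coordinate and is summed here. -/
noncomputable def translationGauge (B : ℤ × ℤ → ℝ) (h n : ℤ × ℤ) : ℝ :=
  signedSum (fun l => vectorPotential B 0 (l, h.2)) n.1

theorem translationGauge_sub_latticeBasis_zero (B : ℤ × ℤ → ℝ) (h n : ℤ × ℤ) :
    translationGauge B h n =
      translationGauge B h (n - latticeBasis 0) + vectorPotential B 0 (n.1, h.2) := by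
  simpa [translationGauge, latticeBasis] using
    signedSum_add_one (fun l => vectorPotential B 0 (l, h.2)) (n.1 - 1)

theorem vectorPotential_add (B : ℤ × ℤ → ℝ) (j : Fin 2) (h n : ℤ × ℤ) :
    vectorPotential B j (n + h) + translationGauge B h (n + h - latticeBasis j) =
      translationGauge B h (n + h) + vectorPotential (fun m => B (m + h)) j n := by
  fin_cases j
  · have potential : vectorPotential B 0 (n + h) =
        vectorPotential B 0 ((n + h).1, h.2) + vectorPotential (fun m => B (m + h)) 0 n := by
      simp only [vectorPotential_zero]
      exact signedSum_add _ _ _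
    rw [Fin.zero_eta, potential, translationGauge_sub_latticeBasis_zero B h (n + h)]
    ring
  · simp [vectorPotential_one, translationGauge, latticeBasis]

end VectorPotential

section LimitFields

variable {B B' : ℤ × ℤ → ℝ}

/-- The field `B'` is a limit of `B` at infinity: along a sequence of translations that tends to
infinity, the translates of `B` are eventually equal to `B'` at each point. -/
def IsLimitField (B B' : ℤ × ℤ → ℝ) : Prop :=
  ∃ h : ℕ → ℤ × ℤ, Tendsto h atTop cofinite ∧ ∀ n, ∀ᶠ k in atTop, B (n + h k) = B' n

/-- The unital C⋆-algebra generated by the pairs of magnetic translations of the fields `B` and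
`B'`. If there is an evaluation homomorphism between their magnetic algebras, this is its graph. -/
noncomputable def magneticPairAlgebra (B B' : ℤ × ℤ → ℝ) :
    StarSubalgebra ℂ ((LatticeSpace →L[ℂ] LatticeSpace) × (LatticeSpace →L[ℂ] LatticeSpace)) :=
  generatedCStar fun j => (magneticTranslation B j, magneticTranslation B' j)

theorem IsLimitField.exists_asymptoticallyIntertwined (h : IsLimitField B B') :
    ∃ W : ℕ → LatticeSpace →ₗᵢ[ℂ] LatticeSpace,
      (∀ φ ψ, Tendsto (fun k => inner ℂ φ (W k ψ)) atTop (𝓝 0)) ∧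
        ∀ x ∈ magneticPairAlgebra B B', AsymptoticallyIntertwined atTop W x := by
  obtain ⟨h, to_infinity, limit⟩ := h
  refine ⟨fun k => weightedTranslationIsometry (translationGauge B (h k)) (h k),
    tendsto_inner_weightedTranslationIsometry to_infinity, fun x hx => ?_⟩
  refine .of_mem_generatedCStar (fun j => ?_) (fun j => ?_) hx
  · refine asymptoticallyIntertwined_weightedTranslationIsometry fun n => ?_
    have limit_between : ∀ᶠ k in atTop, ∀ m ∈ Set.uIoc 0 n.2, B ((n.1, m) + h k) = B' (n.1, m) :=
      (eventually_all_finite (Set.finite_Ioc _ _)).2 fun m _ => limit (n.1, m)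
    filter_upwards [limit_between] with k hk
    rw [vectorPotential_add, vectorPotential_congr hk]
  · have (B : ℤ × ℤ → ℝ) : magneticTranslation B j ∈ unitary _ :=
      weightedTranslationIsometry_mem_unitary _ _
    exact Unitary.mem_iff.2
      ⟨Prod.ext (Unitary.star_mul_self_of_mem (this B)) (Unitary.star_mul_self_of_mem (this B')),
      Prod.ext (Unitary.mul_star_self_of_mem (this B)) (Unitary.mul_star_self_of_mem (this B'))⟩

theorem IsLimitField.norm_snd_le_norm_fst (h : IsLimitField B B')
    {x : (LatticeSpace →L[ℂ] LatticeSpace) × (LatticeSpace →L[ℂ] LatticeSpace)}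
    (hx : x ∈ magneticPairAlgebra B B') : ‖x.2‖ ≤ ‖x.1‖ := by
  obtain ⟨W, -, intertwined⟩ := h.exists_asymptoticallyIntertwined
  exact (intertwined x hx).norm_snd_le_norm_fst

theorem IsLimitField.isUnit_snd_of_isFredholm_fst (h : IsLimitField B B')
    {x : (LatticeSpace →L[ℂ] LatticeSpace) × (LatticeSpace →L[ℂ] LatticeSpace)}
    (hx : x ∈ magneticPairAlgebra B B') (fredholm : x.1.IsFredholm) : IsUnit x.2 := by
  obtain ⟨W, weakly_null, intertwined⟩ := h.exists_asymptoticallyIntertwined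
  exact (intertwined x hx).isUnit_snd_of_isFredholm_fst (intertwined _ (star_mem hx)) weakly_null
    fredholm

instance isClosed_magneticAlgebra (B : ℤ × ℤ → ℝ) :
    IsClosed (magneticAlgebra B : Set (LatticeSpace →L[ℂ] LatticeSpace)) :=
  StarSubalgebra.isClosed_topologicalClosure _

variable {ev ev' : magneticAlgebra B →⋆ₐ[ℂ] magneticAlgebra B'}

theorem IsEvaluation.unique (h : IsEvaluation ev) (h' : IsEvaluation ev') : ev = ev' := by
  refine StarAlgHom.ext_topologicalClosure (map_continuous ev) (map_continuous ev') ?_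
  refine StarAlgHom.ext_adjoin ?_
  rintro ⟨_, _⟩ ⟨j, rfl⟩
  exact (h.map_generator j).trans (h'.map_generator j).symm

theorem IsLimitField.exists_isEvaluation (h : IsLimitField B B') :
    ∃ ev : magneticAlgebra B →⋆ₐ[ℂ] magneticAlgebra B', IsEvaluation ev ∧
      ∀ t : magneticAlgebra B, (t.1, (ev t).1) ∈ magneticPairAlgebra B B' := by
  have norm_le : ∀ x ∈ magneticPairAlgebra B B', ‖x.2‖ ≤ ‖x.1‖ := fun _ => h.norm_snd_le_norm_fst
  obtain ⟨ev, surjective, graph⟩ := exists_surjective_starAlgHom_of_norm_snd_le norm_le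
  exact ⟨ev, ⟨surjective, fun j => Subtype.ext <| eq_of_pair_mem_generatedCStar norm_le
    (graph (magneticGenerator B j)) (mem_generatedCStar _ j)⟩, graph⟩

theorem IsLimitField.existsUnique_isEvaluation (h : IsLimitField B B') :
    ∃! ev : magneticAlgebra B →⋆ₐ[ℂ] magneticAlgebra B', IsEvaluation ev := by
  obtain ⟨ev, evaluation, -⟩ := h.exists_isEvaluation
  exact ⟨ev, evaluation, fun _ h' => h'.unique evaluation⟩

theorem IsEvaluation.mem_magneticPairAlgebra (hev : IsEvaluation ev) (h : IsLimitField B B')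
    (t : magneticAlgebra B) : (t.1, (ev t).1) ∈ magneticPairAlgebra B B' := by
  obtain ⟨ev', evaluation, graph⟩ := h.exists_isEvaluation
  rw [hev.unique evaluation]
  exact graph t

theorem IsEvaluation.isUnit_of_isFredholm (hev : IsEvaluation ev) (h : IsLimitField B B')
    {t : magneticAlgebra B} (fredholm : (t : LatticeSpace →L[ℂ] LatticeSpace).IsFredholm) :
    IsUnit (ev t) := by
  rw [← StarSubalgebra.coe_isUnit]
  exact h.isUnit_snd_of_isFredholm_fst (hev.mem_magneticPairAlgebra h t) fredholm

end LimitFields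

section MagneticLocality

variable {B B' : ℤ × ℤ → ℝ}

/-- The points at which the standard vector potentials of `B` and `B'` agree. -/
def agreementSet (B B' : ℤ × ℤ → ℝ) : Set (ℤ × ℤ) :=
  {n | ∀ j, vectorPotential B j n = vectorPotential B' j n}

theorem norm_latticeBasis (j : Fin 2) : ‖latticeBasis j‖ = 1 := by
  fin_cases j <;> simp [latticeBasis, Prod.norm_def]

theorem coincideDeepInside_magneticTranslation (B B' : ℤ × ℤ → ℝ) (j : Fin 2) :
    CoincideDeepInside (agreementSet B B') (magneticTranslation B j, magneticTranslation B' j) := by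
  refine ⟨1, fun n hn ψ φ h => ?_⟩
  have neighbour : n - latticeBasis j ∈ Metric.closedBall n (1 : ℝ) := by
    rw [Metric.mem_closedBall, dist_self_sub_left, norm_latticeBasis]
  have agree : n ∈ agreementSet B B' := hn (Metric.mem_closedBall_self zero_le_one)
  simp only [magneticTranslation_apply]
  rw [agree j, h _ neighbour]

theorem coincideDeepInside_star_magneticTranslation (B B' : ℤ × ℤ → ℝ) (j : Fin 2) :
    CoincideDeepInside (agreementSet B B')
      (star (magneticTranslation B j), star (magneticTranslation B' j)) := by
  refine ⟨1, fun n hn ψ φ h => ?_⟩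
  have neighbour : n + latticeBasis j ∈ Metric.closedBall n (1 : ℝ) := by
    rw [Metric.mem_closedBall, dist_self_add_left, norm_latticeBasis]
  have agree : n + latticeBasis j ∈ agreementSet B B' := hn neighbour
  simp only [magneticTranslation, star_weightedTranslationIsometry,
    LinearIsometry.coe_toContinuousLinearMap, weightedTranslationIsometry_apply, sub_neg_eq_add]
  rw [agree j, h _ neighbour]

theorem mem_closure_coincideDeepInside_of_mem_magneticPairAlgebra
    {x : (LatticeSpace →L[ℂ] LatticeSpace) × (LatticeSpace →L[ℂ] LatticeSpace)}
    (hx : x ∈ magneticPairAlgebra B B') :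
    x ∈ closure {y | CoincideDeepInside (agreementSet B B') y} := by
  refine closure_mono (fun x hx => ?_) hx
  rw [SetLike.mem_coe, ← StarSubalgebra.mem_toSubalgebra, StarAlgebra.adjoin_toSubalgebra] at hx
  induction hx using Algebra.adjoin_induction with
  | mem x hx =>
    rcases hx with ⟨j, rfl⟩ | ⟨j, hj⟩
    · exact coincideDeepInside_magneticTranslation B B' j
    · rw [← star_star x, ← hj]
      exact coincideDeepInside_star_magneticTranslation B B' j
  | algebraMap c => exact .algebraMap c
  | add _ _ _ _ h h' => exact h.add h'
  | mul _ _ _ _ h h' => exact h.mul h'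

end MagneticLocality

section TwoLimitFields

variable {B B₁ B₂ : ℤ × ℤ → ℝ} {ev₁ : magneticAlgebra B →⋆ₐ[ℂ] magneticAlgebra B₁}
  {ev₂ : magneticAlgebra B →⋆ₐ[ℂ] magneticAlgebra B₂}

theorem isApproximable_of_evaluation_eq_zero (limit₁ : IsLimitField B B₁)
    (limit₂ : IsLimitField B B₂)
    (finite : ∀ s, (erosion (agreementSet B B₁) s ∪ erosion (agreementSet B B₂) s)ᶜ.Finite)
    (h₁ : IsEvaluation ev₁) (h₂ : IsEvaluation ev₂) {t : magneticAlgebra B} (ht₁ : ev₁ t = 0)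
    (ht₂ : ev₂ t = 0) : IsApproximable (t : LatticeSpace →L[ℂ] LatticeSpace) := by
  have pair₁ := h₁.mem_magneticPairAlgebra limit₁ t
  have pair₂ := h₂.mem_magneticPairAlgebra limit₂ t
  rw [ht₁] at pair₁
  rw [ht₂] at pair₂
  exact isApproximable_of_mem_closure_coincideDeepInside finite
    (mem_closure_coincideDeepInside_of_mem_magneticPairAlgebra pair₁)
    (mem_closure_coincideDeepInside_of_mem_magneticPairAlgebra pair₂)

theorem isFredholm_of_isUnit_evaluation (limit₁ : IsLimitField B B₁) (limit₂ : IsLimitField B B₂)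
    (finite : ∀ s, (erosion (agreementSet B B₁) s ∪ erosion (agreementSet B B₂) s)ᶜ.Finite)
    (h₁ : IsEvaluation ev₁) (h₂ : IsEvaluation ev₂) {t : magneticAlgebra B}
    (ht₁ : IsUnit (ev₁ t)) (ht₂ : IsUnit (ev₂ t)) :
    (t : LatticeSpace →L[ℂ] LatticeSpace).IsFredholm := by
  obtain ⟨b, left_inverse, right_inverse⟩ :=
    exists_map_mul_eq_one_of_isUnit_map (ev₁.prod ev₂) (Prod.isUnit_iff.2 ⟨ht₁, ht₂⟩)
  have fredholm {a : magneticAlgebra B} (ha : ev₁.prod ev₂ a = 1) :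
      (a : LatticeSpace →L[ℂ] LatticeSpace).IsFredholm := by
    refine isFredholm_of_isApproximable_sub_one ?_
    have kernel : ev₁.prod ev₂ (a - 1) = 0 := by rw [map_sub, ha, map_one, sub_self]
    exact isApproximable_of_evaluation_eq_zero limit₁ limit₂ finite h₁ h₂
      (congrArg Prod.fst kernel) (congrArg Prod.snd kernel)
  exact isFredholm_of_comp_left_of_comp_right (fredholm left_inverse) (fredholm right_inverse)

theorem mainTheorem8_general (limit₁ : IsLimitField B B₁) (limit₂ : IsLimitField B B₂)
    (finite : ∀ s, (erosion (agreementSet B B₁) s ∪ erosion (agreementSet B B₂) s)ᶜ.Finite) :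
    (∃! ev₁ : magneticAlgebra B →⋆ₐ[ℂ] magneticAlgebra B₁, IsEvaluation ev₁) ∧
    (∃! ev₂ : magneticAlgebra B →⋆ₐ[ℂ] magneticAlgebra B₂, IsEvaluation ev₂) ∧
    ∀ (ev₁ : magneticAlgebra B →⋆ₐ[ℂ] magneticAlgebra B₁)
      (ev₂ : magneticAlgebra B →⋆ₐ[ℂ] magneticAlgebra B₂), IsEvaluation ev₁ → IsEvaluation ev₂ →
      ∀ t : magneticAlgebra B,
        (t : LatticeSpace →L[ℂ] LatticeSpace).IsFredholm ↔ IsUnit (ev₁ t) ∧ IsUnit (ev₂ t) :=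
  ⟨limit₁.existsUnique_isEvaluation, limit₂.existsUnique_isEvaluation, fun _ _ h₁ h₂ _ =>
    ⟨fun fredholm =>
      ⟨h₁.isUnit_of_isFredholm limit₁ fredholm, h₂.isUnit_of_isFredholm limit₂ fredholm⟩,
    fun ⟨ht₁, ht₂⟩ => isFredholm_of_isUnit_evaluation limit₁ limit₂ finite h₁ h₂ ht₁ ht₂⟩⟩

end TwoLimitFields

section QuarterPlane

theorem isLimitField_rightField (bIn bOut : ℝ) :
    IsLimitField (quarterPlaneField bIn bOut) (rightField bIn bOut) := by
  refine ⟨fun k => (k, 0), ?_, fun n => ?_⟩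
  · rw [← Nat.cofinite_eq_atTop]
    exact Function.Injective.tendsto_cofinite fun a b h => by simpa using h
  · filter_upwards [eventually_gt_atTop (-n.1).toNat] with k hk
    have column : ¬ n.1 + k ≤ 0 := by lia
    simp [quarterPlaneField, rightField, column]

theorem isLimitField_upField (bIn bOut : ℝ) :
    IsLimitField (quarterPlaneField bIn bOut) (upField bIn bOut) := by
  refine ⟨fun k => (0, k), ?_, fun n => ?_⟩
  · rw [← Nat.cofinite_eq_atTop]
    exact Function.Injective.tendsto_cofinite fun a b h => by simpa using h
  · filter_upwards [eventually_gt_atTop (-n.2).toNat] with k hk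
    have row : ¬ n.2 + k ≤ 0 := by lia
    simp [quarterPlaneField, upField, row]

theorem subset_agreementSet_rightField (bIn bOut : ℝ) :
    {n | 0 < n.1 ∨ n.2 < 0} ⊆ agreementSet (quarterPlaneField bIn bOut) (rightField bIn bOut) := by
  refine fun n (hn : _ ∨ _) => vectorPotential_congr fun m hm => ?_
  rw [Set.mem_uIoc] at hm
  have : n.1 ≤ 0 ∨ m ≤ 0 ↔ m ≤ 0 := by lia
  simp only [quarterPlaneField, rightField, this]

theorem subset_agreementSet_upField (bIn bOut : ℝ) :
    {n | n.1 < 0 ∨ 0 < n.2} ⊆ agreementSet (quarterPlaneField bIn bOut) (upField bIn bOut) := by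
  refine fun n (hn : _ ∨ _) => vectorPotential_congr fun m hm => ?_
  rw [Set.mem_uIoc] at hm
  have : n.1 ≤ 0 ∨ m ≤ 0 ↔ n.1 ≤ 0 := by lia
  simp only [quarterPlaneField, upField, this]

theorem abs_sub_le_of_mem_closedBall {m n : ℤ × ℤ} {s : ℝ} (h : m ∈ Metric.closedBall n s) :
    |m.1 - n.1| ≤ ⌊s⌋ ∧ |m.2 - n.2| ≤ ⌊s⌋ := by
  rw [Metric.mem_closedBall, Prod.dist_eq, max_le_iff, Int.dist_eq, Int.dist_eq] at h
  constructor <;> rw [Int.le_floor] <;> push_cast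
  exacts [h.1, h.2]

theorem finite_compl_union_erosion_agreementSet (bIn bOut : ℝ) (s : NNReal) :
    (erosion (agreementSet (quarterPlaneField bIn bOut) (rightField bIn bOut)) s ∪
      erosion (agreementSet (quarterPlaneField bIn bOut) (upField bIn bOut)) s)ᶜ.Finite := by
  set N := ⌊(s : ℝ)⌋
  refine (Set.finite_Icc (-N, -N) (N, N)).subset fun n hn => ?_
  rw [Set.mem_compl_iff, Set.mem_union, not_or] at hn
  have not_right : ¬ (N < n.1 ∨ n.2 < -N) := fun h => hn.1 fun m hm =>
    subset_agreementSet_rightField bIn bOut <| by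
      obtain ⟨h₁, h₂⟩ := abs_sub_le_of_mem_closedBall hm
      rw [abs_le] at h₁ h₂
      change _ ∨ _
      lia
  have not_up : ¬ (n.1 < -N ∨ N < n.2) := fun h => hn.2 fun m hm =>
    subset_agreementSet_upField bIn bOut <| by
      obtain ⟨h₁, h₂⟩ := abs_sub_le_of_mem_closedBall hm
      rw [abs_le] at h₁ h₂
      change _ ∨ _
      lia
  rw [Set.mem_Icc, Prod.mk_le_mk, Prod.le_def]
  lia

end QuarterPlane

theorem mainTheorem8 (bIn bOut : ℝ) (hb : ∀ k : ℤ, bIn - bOut ≠ 2 * Real.pi * (k : ℝ)) :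
    (∃! evR : magneticAlgebra (quarterPlaneField bIn bOut) →⋆ₐ[ℂ]
        magneticAlgebra (rightField bIn bOut), IsEvaluation evR) ∧
    (∃! evU : magneticAlgebra (quarterPlaneField bIn bOut) →⋆ₐ[ℂ]
        magneticAlgebra (upField bIn bOut), IsEvaluation evU) ∧
    ∀ (evR : magneticAlgebra (quarterPlaneField bIn bOut) →⋆ₐ[ℂ]
        magneticAlgebra (rightField bIn bOut))
      (evU : magneticAlgebra (quarterPlaneField bIn bOut) →⋆ₐ[ℂ]
        magneticAlgebra (upField bIn bOut)),
      IsEvaluation evR → IsEvaluation evU →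
      ∀ t : magneticAlgebra (quarterPlaneField bIn bOut),
        (t : LatticeSpace →L[ℂ] LatticeSpace).IsFredholm ↔ IsUnit (evR t) ∧ IsUnit (evU t) :=
  mainTheorem8_general (isLimitField_rightField bIn bOut) (isLimitField_upField bIn bOut)
    (finite_compl_union_erosion_agreementSet bIn bOut)
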